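/- Let $\mathbb N=\{1,2,\dots\}$. For $n\in\mathbb N$ let $\mu_n$ be the standard Gaussian measure on $\mathbb R^n$, and let $\mu_\infty$ be the Gaussian measure on $\mathbb R^\infty$ (the countable product of standard normal distributions); all $L^2$-spaces are complex. For $k\le l$ let $\delta^k\colon\mathbb R^\infty\to\mathbb R^k$ and $\delta^k_l\colon\mathbb R^l\to\mathbb R^k$ be the projections onto the first $k$ coordinates. The isometries $\Lambda_k f=f\circ\delta^k$ and $\Lambda_k^l f=f\circ\delta_l^k$ make $L^2(\mu_\infty)$ the inductive limit of the spaces $L^2(\mu_n)$. Given operators $C_n$ in $L^2(\mu_n)$, the operator $\lim C_n$ in $L^2(\mu_\infty)$ has as its domain all $\Lambda_k f$, where $k\in\mathbb N$ and $f\in L^2(\mu_k)$ are such that, for some $M\ge k$, $\Lambda_k^m f\in\mathrm{dom}(C_m)$ for all $m\ge M$, and $\lim_{m\to\infty}\Lambda_mC_m\Lambda_k^mf$ exists; this limit is the value of $\lim C_n$ at $\Lambda_kf$. For a measurable map $A$ of a measure space $(X,\mu)$ into itself that is nonsingular ($\mu\circ A^{-1}\ll\mu$), the composition operator $C_A$ in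 $L^2(\mu)$ is $C_Af=f\circ A$ with domain $\{f\in L^2(\mu): f\circ A\in L^2(\mu)\}$. Let $\mathscr S$ be the linear span in $L^2(\mu_\infty)$ of all characteristic functions of measurable sets which belong to $\bigcup_{n}\Lambda_nL^2(\mu_n)$. For measures $\nu_i$ and functions $f_i\in L^1(\nu_i)$, $i\in I$, let $\mathfrak M(\{f_i : i\in I\})$ be the set of all monotonically increasing convex functions $G\colon[0,\infty)\to[0,\infty)$ with $\lim_{t\to\infty}G(t)/t=\infty$ and $\sup_{i}\int G(|f_i|)\,d\nu_i<\infty$. Let $(a_{ij})_{i,j\in\mathbb N}$ be a real matrix, let $A$ be the transformation of $\mathbb R^\infty$ induced by it, $(Ax)_i=\sum_{j}a_{ij}x_j$, and let $A_n$ be the linear transformation of $\mathbb R^n$ induced by $(a_{ij})_{i,j=1}^n$. Let $\|\cdot\|$ denote Euclidean norms. Assume that: (i) $A_n$ is invertible for every $n\in\mathbb N$; (ii) for every $j\in\mathbb N$ there is $K\in\mathbb N$ such that $a_{jk}=0$ for all $k\ge K$; (iii) there are Borel sets $\sigma_k\subseteq\mathbb R^k$, $k\in\mathbb N$, such that the sets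 $\sigma_k\times\mathbb R^\infty$ increase with $k$ and have union $\mathbb R^\infty$, and, for every $k\in\mathbb N$, the functions $$h_{k,n}(x)=\chi_{\sigma_k\times\mathbb R^{n-k}}(x)\,\exp\tfrac12\big(\|x\|^2-\|A_n^{-1}x\|^2\big),\qquad x\in\mathbb R^n,\ n\ge k,$$ satisfy $h_{k,n}\in L^1(\mu_n)$ for all $n\ge k$, and $\mathfrak M\big(\{|\det A_n^{-1}|\,h_{k,n} : n\ge k\}\big)\neq\varnothing$. Then $A$ and all $A_n$ are nonsingular (with respect to $\mu_\infty$ and $\mu_n$), $C_A$ is densely defined in $L^2(\mu_\infty)$, the set $\tilde{\mathscr S}=\{\chi_{\sigma_k\times\mathbb R^\infty}f : f\in\mathscr S,\ k\in\mathbb N\}$ is a linear subspace of $\mathrm{dom}(\lim C_{A_n})$, the restriction $(\lim C_{A_n})|_{\tilde{\mathscr S}}$ is closable, and $$C_A=\overline{(\lim C_{A_n})|_{\tilde{\mathscr S}}}.$$ -/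

import Mathlib

open MeasureTheory ProbabilityTheory Filter Topology
open scoped ENNReal

noncomputable section

namespace GaussComp

/-! ### Inductive limits of Hilbert spaces and of operators -/

section InductiveLimits

/-- The Hilbert space `K` is the inductive limit of the Hilbert spaces `H n`, `n = 1, 2, …`, with
respect to the isometries `trans : H k → H l` (`k ≤ l`) and `incl k : H k → K`. -/
structure InductiveLimit (H : ℕ+ → Type*) [∀ n, NormedAddCommGroup (H n)]
    [∀ n, InnerProductSpace ℂ (H n)] (K : Type*) [NormedAddCommGroup K]
    [InnerProductSpace ℂ K] where
  trans : ∀ {k l : ℕ+}, k ≤ l → H k →ₗᵢ[ℂ] H l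
  incl : ∀ k : ℕ+, H k →ₗᵢ[ℂ] K
  trans_refl : ∀ (k : ℕ+) (f : H k), trans (le_refl k) f = f
  trans_trans : ∀ {k l m : ℕ+} (hkl : k ≤ l) (hlm : l ≤ m) (f : H k),
    trans (hkl.trans hlm) f = trans hlm (trans hkl f)
  incl_trans : ∀ {k l : ℕ+} (hkl : k ≤ l) (f : H k), incl k f = incl l (trans hkl f)
  dense : Dense (⋃ n, Set.range (incl n))

variable {H : ℕ+ → Type*} [∀ n, NormedAddCommGroup (H n)] [∀ n, InnerProductSpace ℂ (H n)]
  {K : Type*} [NormedAddCommGroup K] [InnerProductSpace ℂ K]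

/-- `LimRel L C k f y` says that there is `M ≥ k` such that `Λ_k^m f ∈ dom (C m)` for all `m ≥ M`,
and that `Λ_m C_m Λ_k^m f → y` as `m → ∞`. The sequence `v` carries the vectors `C_m Λ_k^m f` for
`m ≥ M` (its other terms are irrelevant). -/
def LimRel (L : InductiveLimit H K) (C : ∀ n, H n →ₗ.[ℂ] H n) (k : ℕ+) (f : H k) (y : K) : Prop :=
  ∃ v : ∀ m, H m,
    (∃ M : ℕ+, k ≤ M ∧ ∀ m, M ≤ m → ∀ hkm : k ≤ m, (L.trans hkm f, v m) ∈ (C m).graph) ∧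
    Tendsto (fun m => L.incl m (v m)) atTop (𝓝 y)

theorem LimRel.trans {L : InductiveLimit H K} {C : ∀ n, H n →ₗ.[ℂ] H n} {k l : ℕ+} {f : H k} {y : K}
    (h : LimRel L C k f y) (hkl : k ≤ l) : LimRel L C l (L.trans hkl f) y := by
  obtain ⟨v, ⟨M, hkM, hM⟩, hv⟩ := h
  refine ⟨v, ⟨max M l, le_max_right _ _, fun m hm hlm => ?_⟩, hv⟩
  rw [← L.trans_trans hkl hlm]
  exact hM m ((le_max_left _ _).trans hm) _

theorem LimRel.add {L : InductiveLimit H K} {C : ∀ n, H n →ₗ.[ℂ] H n} {k : ℕ+} {f g : H k} {y z : K}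
    (h : LimRel L C k f y) (h' : LimRel L C k g z) : LimRel L C k (f + g) (y + z) := by
  obtain ⟨v, ⟨M, hkM, hM⟩, hv⟩ := h
  obtain ⟨w, ⟨N, hkN, hN⟩, hw⟩ := h'
  refine ⟨fun m => v m + w m, ⟨max M N, hkM.trans (le_max_left _ _), fun m hm hkm => ?_⟩, ?_⟩
  · have := (C m).graph.add_mem (hM m ((le_max_left _ _).trans hm) hkm)
      (hN m ((le_max_right _ _).trans hm) hkm)
    simpa using this
  · simpa using hv.add hw

theorem LimRel.smul {L : InductiveLimit H K} {C : ∀ n, H n →ₗ.[ℂ] H n} {k : ℕ+} {f : H k} {y : K}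
    (h : LimRel L C k f y) (c : ℂ) : LimRel L C k (c • f) (c • y) := by
  obtain ⟨v, ⟨M, hkM, hM⟩, hv⟩ := h
  refine ⟨fun m => c • v m, ⟨M, hkM, fun m hm hkm => ?_⟩, ?_⟩
  · have := (C m).graph.smul_mem c (hM m hm hkm)
    simpa using this
  · simpa using hv.const_smul c

/-- The graph `{(Λ_k f, lim_m Λ_m C_m Λ_k^m f)}` of the inductive limit of the operators `C n`. -/
def limGraph (L : InductiveLimit H K) (C : ∀ n, H n →ₗ.[ℂ] H n) : Submodule ℂ (K × K) where
  carrier := {p | ∃ (k : ℕ+) (f : H k), p.1 = L.incl k f ∧ LimRel L C k f p.2}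
  zero_mem' := ⟨1, 0, by simp, fun _ => 0,
    ⟨1, le_rfl, fun m _ _ => by simp⟩, by simp⟩
  add_mem' := by
    rintro p q ⟨k, f, hp, hf⟩ ⟨l, g, hq, hg⟩
    refine ⟨max k l, L.trans (le_max_left k l) f + L.trans (le_max_right k l) g, ?_,
      (hf.trans _).add (hg.trans _)⟩
    rw [map_add, ← L.incl_trans, ← L.incl_trans, Prod.fst_add, hp, hq]
  smul_mem' := by
    rintro c p ⟨k, f, hp, hf⟩
    exact ⟨k, c • f, by simp [hp], hf.smul c⟩

/-- The limit defining the inductive limit operator does not depend on the choice of `k`, `f`. -/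
theorem limGraph_single_valued (L : InductiveLimit H K) (C : ∀ n, H n →ₗ.[ℂ] H n) :
    ∀ p ∈ limGraph L C, p.1 = 0 → p.2 = 0 := by
  rintro ⟨x, y⟩ ⟨k, f, hp, v, ⟨M, hkM, hM⟩, hv⟩ h0
  simp only at hp h0 hv ⊢
  have hf : f = 0 := (L.incl k).injective (by rw [← hp, h0, map_zero])
  subst hf
  refine tendsto_nhds_unique hv (tendsto_const_nhds.congr' ?_)
  filter_upwards [eventually_ge_atTop M] with m hm
  have h1 := hM m hm (hkM.trans hm)
  rw [map_zero] at h1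
  rw [(C m).graph_fst_eq_zero_snd h1 rfl, map_zero]

/-- The inductive limit of the operators `C n` in `H n`: an operator in `K`. -/
def limOp (L : InductiveLimit H K) (C : ∀ n, H n →ₗ.[ℂ] H n) : K →ₗ.[ℂ] K :=
  (limGraph L C).toLinearPMap

theorem limOp_graph (L : InductiveLimit H K) (C : ∀ n, H n →ₗ.[ℂ] H n) :
    (limOp L C).graph = limGraph L C :=
  (limGraph L C).toLinearPMap_graph_eq (limGraph_single_valued L C)

end InductiveLimits

/-! ### Composition operators -/

section CompositionOperators

variable {X : Type*} [MeasurableSpace X]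

/-- The composition operator `C_A f = f ∘ A` in the complex space `L²(μ)` with its maximal domain
`{f ∈ L²(μ) : f ∘ A ∈ L²(μ)}`, for a nonsingular transformation `A` (that is, `A` is measurable and
`μ ∘ A⁻¹ ≪ μ`, so that `f ∘ A` does not depend on the representative of `f`). -/
def compOp {μ : Measure X} {A : X → X} (hA : Measure.QuasiMeasurePreserving A μ μ) :
    Lp ℂ 2 μ →ₗ.[ℂ] Lp ℂ 2 μ where
  domain :=
    { carrier := {f | MemLp (f ∘ A) 2 μ}
      zero_mem' := (memLp_congr_ae (hA.ae_eq_comp (Lp.coeFn_zero ℂ 2 μ))).2 MemLp.zero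
      add_mem' := fun {f g} hf hg =>
        (memLp_congr_ae (hA.ae_eq_comp (Lp.coeFn_add f g))).2 (MemLp.add hf hg)
      smul_mem' := fun c f hf =>
        (memLp_congr_ae (hA.ae_eq_comp (Lp.coeFn_smul c f))).2 (MemLp.const_smul hf c) }
  toFun :=
    { toFun := fun f => MemLp.toLp ((f : Lp ℂ 2 μ) ∘ A) f.2
      map_add' := fun f g => by
        rw [← MemLp.toLp_add]
        exact MemLp.toLp_congr _ _ (hA.ae_eq_comp (Lp.coeFn_add (f : Lp ℂ 2 μ) (g : Lp ℂ 2 μ)))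
      map_smul' := fun c f => by
        rw [RingHom.id_apply, ← MemLp.toLp_const_smul]
        exact MemLp.toLp_congr _ _ (hA.ae_eq_comp (Lp.coeFn_smul c (f : Lp ℂ 2 μ))) }

end CompositionOperators

/-- For a family of functions `f i ∈ L¹(μ i)`: the set of all monotonically increasing convex
functions `G : [0, ∞) → [0, ∞)` such that `G(t)/t → ∞` as `t → ∞` and `sup_i ∫ G(|f i|) dμ_i < ∞`.
(Only the values of `G` on `[0, ∞)` matter.) -/
def superlinearClass {ι : Type*} {X : ι → Type*} [∀ i, MeasurableSpace (X i)]
    (μ : ∀ i, Measure (X i)) (f : ∀ i, X i → ℝ) : Set (ℝ → ℝ) :=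
  {G | (∀ t, 0 ≤ t → 0 ≤ G t) ∧ MonotoneOn G (Set.Ici 0) ∧ ConvexOn ℝ (Set.Ici 0) G ∧
    Tendsto (fun t => G t / t) atTop atTop ∧
    ⨆ i, ∫⁻ x, ENNReal.ofReal (G |f i x|) ∂(μ i) < ∞}

/-! ### Gaussian measures on `ℝⁿ` and `ℝ^∞`

The coordinates of `ℝⁿ = Fin n → ℝ` and `ℝ^∞ = ℕ → ℝ` are numbered from `0`. -/

/-- The standard Gaussian measure on `ℝⁿ`. -/
def gaussN (n : ℕ) : Measure (Fin n → ℝ) := Measure.pi fun _ => gaussianReal 0 1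

/-- The Gaussian measure on `ℝ^∞`: the countable product of standard normal distributions. -/
def gaussInf : Measure (ℕ → ℝ) := Measure.infinitePi fun _ => gaussianReal 0 1

instance (n : ℕ) : IsProbabilityMeasure (gaussN n) := by unfold gaussN; infer_instance

instance : IsProbabilityMeasure gaussInf := by unfold gaussInf; infer_instance

/-- The projection of `ℝ^∞` onto the first `n` coordinates. -/
def proj (n : ℕ) (x : ℕ → ℝ) : Fin n → ℝ := fun i => x i

/-- The projection of `ℝ^l` onto the first `k ≤ l` coordinates. -/
def projFin {k l : ℕ} (h : k ≤ l) (x : Fin l → ℝ) : Fin k → ℝ := fun i => x (Fin.castLE h i)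

theorem measurable_proj (n : ℕ) : Measurable (proj n) :=
  measurable_pi_lambda _ fun i => measurable_pi_apply (i : ℕ)

theorem measurable_projFin {k l : ℕ} (h : k ≤ l) : Measurable (projFin h) :=
  measurable_pi_lambda _ fun i => measurable_pi_apply (Fin.castLE h i)

theorem projFin_comp_proj {k l : ℕ} (h : k ≤ l) : projFin h ∘ proj l = proj k := rfl

theorem projFin_comp_projFin {k l m : ℕ} (hkl : k ≤ l) (hlm : l ≤ m) :
    projFin hkl ∘ projFin hlm = projFin (hkl.trans hlm) := rfl

theorem measurePreserving_proj (n : ℕ) : MeasurePreserving (proj n) gaussInf (gaussN n) := by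
  refine ⟨measurable_proj n, ?_⟩
  refine (Measure.pi_eq fun s hs => ?_).symm
  rw [Measure.map_apply (measurable_proj n) (MeasurableSet.univ_pi hs)]
  let t : ℕ → Set ℝ := fun i => if h : i < n then s ⟨i, h⟩ else Set.univ
  have ht : ∀ i : Fin n, t i = s i := fun i => by simp [t]
  have hpre : proj n ⁻¹' Set.univ.pi s = Set.pi (Finset.range n : Set ℕ) t := by
    ext x
    simp only [Set.mem_preimage, Set.mem_pi, Set.mem_univ, true_imp_iff, Finset.coe_range,
      Set.mem_Iio, proj]
    exact ⟨fun h i hi => (ht ⟨i, hi⟩) ▸ h ⟨i, hi⟩, fun h i => ht i ▸ h i i.2⟩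
  rw [hpre, gaussInf, Measure.infinitePi_pi, ← Fin.prod_univ_eq_prod_range
    (fun i => gaussianReal 0 1 (t i)) n]
  · simp only [ht]
  · intro i hi
    have := Finset.mem_range.1 hi
    simp only [t, dif_pos this]
    exact hs _

theorem measurePreserving_projFin {k l : ℕ} (h : k ≤ l) :
    MeasurePreserving (projFin h) (gaussN l) (gaussN k) := by
  refine ⟨measurable_projFin h, ?_⟩
  rw [← (measurePreserving_proj l).map_eq, Measure.map_map (measurable_projFin h)
    (measurable_proj l), projFin_comp_proj, (measurePreserving_proj k).map_eq]

/-- The family of cylinder sets of `ℝ^∞`. -/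
def cylinders : Set (Set (ℕ → ℝ)) := {s | ∃ (n : ℕ+) (σ : Set (Fin n → ℝ)),
  MeasurableSet σ ∧ proj n ⁻¹' σ = s}

theorem isSetAlgebra_cylinders : IsSetAlgebra cylinders where
  empty_mem := ⟨1, ∅, MeasurableSet.empty, rfl⟩
  compl_mem := by
    rintro s ⟨n, σ, hσ, rfl⟩
    exact ⟨n, σᶜ, hσ.compl, rfl⟩
  union_mem := by
    rintro s t ⟨n, σ, hσ, rfl⟩ ⟨m, τ, hτ, rfl⟩
    have hn : (n : ℕ) ≤ (max n m : ℕ+) := PNat.coe_le_coe _ _ |>.2 (le_max_left n m)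
    have hm : (m : ℕ) ≤ (max n m : ℕ+) := PNat.coe_le_coe _ _ |>.2 (le_max_right n m)
    exact ⟨max n m, projFin hn ⁻¹' σ ∪ projFin hm ⁻¹' τ,
      (measurable_projFin hn hσ).union (measurable_projFin hm hτ), rfl⟩

theorem generateFrom_cylinders :
    (inferInstance : MeasurableSpace (ℕ → ℝ)) = MeasurableSpace.generateFrom cylinders := by
  refine le_antisymm (iSup_le fun i => ?_) (MeasurableSpace.generateFrom_le ?_)
  · rintro s ⟨t, ht, rfl⟩
    refine MeasurableSpace.measurableSet_generateFrom ⟨⟨i + 1, i.succ_pos⟩,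
      (fun x => x ⟨i, i.lt_succ_self⟩) ⁻¹' t, measurable_pi_apply _ ht, rfl⟩
  · rintro s ⟨n, σ, hσ, rfl⟩
    exact measurable_proj n hσ

/-- The isometry `f ↦ f ∘ proj n` of `L²(ℝⁿ)` into `L²(ℝ^∞)`. -/
def projIsometry (n : ℕ) : Lp ℂ 2 (gaussN n) →ₗᵢ[ℂ] Lp ℂ 2 gaussInf :=
  Lp.compMeasurePreservingₗᵢ ℂ (proj n) (measurePreserving_proj n)

/-- The isometry `f ↦ f ∘ projFin h` of `L²(ℝᵏ)` into `L²(ℝˡ)`, where `k ≤ l`. -/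
def projFinIsometry {k l : ℕ} (h : k ≤ l) : Lp ℂ 2 (gaussN k) →ₗᵢ[ℂ] Lp ℂ 2 (gaussN l) :=
  Lp.compMeasurePreservingₗᵢ ℂ (projFin h) (measurePreserving_projFin h)

theorem projIsometry_projFinIsometry {k l : ℕ} (h : k ≤ l) (f : Lp ℂ 2 (gaussN k)) :
    projIsometry k f = projIsometry l (projFinIsometry h f) :=
  Lp.compMeasurePreserving_comp_apply f (measurePreserving_projFin h) (measurePreserving_proj l)

/-- The linear subspace of cylinder functions in `L²(ℝ^∞)`. -/
def cylinderFunctions : Submodule ℂ (Lp ℂ 2 gaussInf) where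
  carrier := ⋃ n : ℕ+, Set.range (projIsometry n)
  zero_mem' := Set.mem_iUnion.2 ⟨1, 0, map_zero _⟩
  add_mem' := by
    intro f g hf hg
    obtain ⟨n, f, rfl⟩ := Set.mem_iUnion.1 hf
    obtain ⟨m, g, rfl⟩ := Set.mem_iUnion.1 hg
    have hn : (n : ℕ) ≤ (max n m : ℕ+) := PNat.coe_le_coe _ _ |>.2 (le_max_left n m)
    have hm : (m : ℕ) ≤ (max n m : ℕ+) := PNat.coe_le_coe _ _ |>.2 (le_max_right n m)
    refine Set.mem_iUnion.2 ⟨max n m, projFinIsometry hn f + projFinIsometry hm g, ?_⟩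
    rw [map_add, ← projIsometry_projFinIsometry, ← projIsometry_projFinIsometry]
  smul_mem' := by
    intro c f hf
    obtain ⟨n, f, rfl⟩ := Set.mem_iUnion.1 hf
    exact Set.mem_iUnion.2 ⟨n, c • f, map_smul _ _ _⟩

theorem dense_cylinderFunctions : Dense (⋃ n : ℕ+, Set.range (projIsometry n)) := by
  change Dense (cylinderFunctions : Set (Lp ℂ 2 gaussInf))
  have hdense : gaussInf.MeasureDense cylinders :=
    Measure.MeasureDense.of_generateFrom_isSetAlgebra_finite gaussInf isSetAlgebra_cylinders
      generateFrom_cylinders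
  have : Fact ((2 : ℝ≥0∞) ≠ ∞) := ⟨by norm_num⟩
  refine fun f => ?_
  change f ∈ cylinderFunctions.topologicalClosure
  refine Lp.induction (by norm_num) (fun f => f ∈ cylinderFunctions.topologicalClosure)
    ?_ ?_ ?_ f
  · intro c s hs hμ
    rw [Lp.simpleFunc.coe_indicatorConst]
    refine closure_mono ?_ (hdense.indicatorConstLp_subset_closure 2 c ⟨s, hs, hμ.ne, rfl⟩)
    rintro _ ⟨_, ⟨n, σ, hσ, rfl⟩, hμσ, rfl⟩
    exact Set.mem_iUnion.2 ⟨n, indicatorConstLp 2 hσ (measure_ne_top _ _) c,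
      (Lp.indicatorConstLp_compMeasurePreserving hσ (measure_ne_top _ _) c
        (measurePreserving_proj n))⟩
  · intro f g hf hg _ hf' hg'
    exact add_mem hf' hg'
  · exact cylinderFunctions.isClosed_topologicalClosure

/-- `L²` of the Gaussian measure on `ℝ^∞` is the inductive limit of the spaces `L²` of the Gaussian
measures on `ℝⁿ`, with respect to the isometries `f ↦ f ∘ projFin` and `f ↦ f ∘ proj`. -/
def gaussInductiveLimit :
    InductiveLimit (fun n : ℕ+ => Lp ℂ 2 (gaussN n)) (Lp ℂ 2 gaussInf) where
  trans {k l} h := projFinIsometry ((PNat.coe_le_coe k l).2 h)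
  incl k := projIsometry k
  trans_refl _ f := Lp.compMeasurePreserving_id_apply f
  trans_trans {_ l m} hkl hlm f := Lp.compMeasurePreserving_comp_apply f
    (measurePreserving_projFin ((PNat.coe_le_coe _ l).2 hkl))
    (measurePreserving_projFin ((PNat.coe_le_coe l m).2 hlm))
  incl_trans {k l} hkl f := projIsometry_projFinIsometry ((PNat.coe_le_coe k l).2 hkl) f
  dense := dense_cylinderFunctions

/-- The linear span of all characteristic functions of sets (of finite measure) that are cylinder
functions, that is, belong to the image of `L²(ℝⁿ)` for some `n`. -/
def cylinderSimple : Submodule ℂ (Lp ℂ 2 gaussInf) :=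
  Submodule.span ℂ
    {f | (∃ (s : Set (ℕ → ℝ)) (hs : MeasurableSet s) (hμ : gaussInf s ≠ ∞),
        f = indicatorConstLp 2 hs hμ (1 : ℂ)) ∧
      ∃ n : ℕ+, f ∈ Set.range (gaussInductiveLimit.incl n)}

/-- The set of all `χ_{σ_k × ℝ^∞} f`, where `k = 1, 2, …` and `f` is in `cylinderSimple`. -/
def localizedCylinderSimple (σ : ∀ k : ℕ+, Set (Fin k → ℝ)) : Set (Lp ℂ 2 gaussInf) :=
  {g | ∃ k : ℕ+, ∃ f ∈ cylinderSimple, g =ᵐ[gaussInf] (proj k ⁻¹' σ k).indicator f}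

/-! ### Transformations induced by matrices -/

/-- The transformation of `ℝ^∞` induced by an infinite matrix. -/
def infMatrixMap (a : Matrix ℕ ℕ ℝ) (x : ℕ → ℝ) : ℕ → ℝ := fun i => ∑' j, a i j * x j

/-- The upper left `n × n` corner of an infinite matrix. -/
def truncMatrix (a : Matrix ℕ ℕ ℝ) (n : ℕ) : Matrix (Fin n) (Fin n) ℝ := fun i j => a i j

/-- The linear transformation of `ℝⁿ` induced by the truncated matrix. -/
def truncMap (a : Matrix ℕ ℕ ℝ) (n : ℕ) (x : Fin n → ℝ) : Fin n → ℝ :=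
  Matrix.mulVec (truncMatrix a n) x

/-- The function `χ_{σ × ℝ^{n-k}}(x) · exp(½(‖x‖² - ‖Aₙ⁻¹ x‖²))` on `ℝⁿ`, with Euclidean norms. -/
def localizedDensity (a : Matrix ℕ ℕ ℝ) {k n : ℕ} (hkn : k ≤ n) (σ : Set (Fin k → ℝ)) :
    (Fin n → ℝ) → ℝ :=
  (projFin hkn ⁻¹' σ).indicator fun x =>
    Real.exp (1 / 2 * (‖WithLp.toLp 2 x‖ ^ 2
      - ‖WithLp.toLp 2 (Matrix.mulVec (truncMatrix a n)⁻¹ x)‖ ^ 2))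

end GaussComp

end

open GaussComp

/-! Write `μ` for the Gaussian measure on `ℝ^∞` and `ν = μ ∘ A⁻¹`. Since the rows of the matrix are
finitely supported, any finite number of coordinates of `Ax` is computed by `A_n` for all large `n`
(`exists_proj_infMatrixMap_eq`). The preimage of a cylinder set under `A` is therefore a cylinder
set given by `A_n`, and on indicators of cylinder sets the sequence defining `lim C_{A_n}` is
eventually constant with value `C_A`.

Nonsingularity of `A` is the analytic point. The image of the Gaussian measure under `A_n` has
density `|det A_n⁻¹| exp(½(‖x‖² - ‖A_n⁻¹x‖²))` (`map_mulVec_gaussN`). By de la Vallée-Poussin these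
densities, cut off to `σ_k`, are uniformly integrable in `n`; so `ν(E ∩ σ_k × ℝ^∞)` is small
whenever the cylinder set `E` has small `μ`-measure. A `μ`-null set is approximated by cylinder sets
in `μ + ν`, which gives `ν ≪ μ`.

For the closure formula, the graph of `C_A` is closed, and its norm is that of `L²(μ + ν)`, in which
simple cylinder functions are dense (`graph_compOp_le`). Cutting off to `σ_k` costs nothing: `s ∩
(σ_k × ℝ^∞)` increases to `s`, so the indicators converge in `L²(μ + ν)`. -/

noncomputable section

namespace GaussComp

/-! ### Densities of finite-dimensional Gaussian measures -/

/-- The density of `gaussN n` with respect to Lebesgue measure. -/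
def gaussDensity (n : ℕ) (x : Fin n → ℝ) : ℝ := ∏ i, gaussianPDFReal 0 1 (x i)

theorem measurable_gaussDensity (n : ℕ) : Measurable (gaussDensity n) :=
  Finset.measurable_prod _ fun i _ =>
    (measurable_gaussianPDFReal 0 1).comp (measurable_pi_apply i)

theorem gaussDensity_nonneg {n : ℕ} (x : Fin n → ℝ) : 0 ≤ gaussDensity n x :=
  Finset.prod_nonneg fun _ _ => gaussianPDFReal_nonneg _ _ _

theorem gaussDensity_eq {n : ℕ} (x : Fin n → ℝ) :
    gaussDensity n x
      = (√(2 * Real.pi))⁻¹ ^ n * Real.exp (-(1 / 2 * ‖WithLp.toLp 2 x‖ ^ 2)) := by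
  simp only [gaussDensity, gaussianPDFReal, Finset.prod_mul_distrib, ← Real.exp_sum,
    EuclideanSpace.norm_sq_eq, Finset.prod_const, Finset.card_univ, Fintype.card_fin]
  congr 2
  · simp
  · rw [Finset.mul_sum, ← Finset.sum_neg_distrib]
    refine Finset.sum_congr rfl fun i _ => ?_
    simp
    ring

/-- A product measure is determined on boxes, where the indicator times the density is a product of
functions of one variable, so that the integral factors. -/
theorem gaussN_eq_withDensity (n : ℕ) :
    gaussN n = volume.withDensity fun x => ENNReal.ofReal (gaussDensity n x) := by
  refine Measure.pi_eq fun s hs => ?_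
  have hbox : MeasurableSet (Set.univ.pi s) := MeasurableSet.univ_pi hs
  have hind : (Set.univ.pi s).indicator (gaussDensity n)
      = fun x => ∏ i, (s i).indicator (gaussianPDFReal 0 1) (x i) := by
    funext x
    by_cases hx : x ∈ Set.univ.pi s
    · rw [Set.indicator_of_mem hx]
      exact Finset.prod_congr rfl fun i _ => (Set.indicator_of_mem (hx i trivial) _).symm
    · rw [Set.indicator_of_notMem hx]
      obtain ⟨i, hi⟩ : ∃ i, x i ∉ s i := by simpa [Set.mem_pi] using hx
      exact (Finset.prod_eq_zero (Finset.mem_univ i) (Set.indicator_of_notMem hi _)).symm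
  have hint : ∀ i, Integrable ((s i).indicator (gaussianPDFReal 0 1)) :=
    fun i => (integrable_gaussianPDFReal 0 1).indicator (hs i)
  have hint' : Integrable ((Set.univ.pi s).indicator (gaussDensity n)) := by
    rw [hind]
    exact Integrable.fintype_prod hint
  rw [withDensity_apply _ hbox, ← lintegral_indicator hbox]
  have : ∀ x, (Set.univ.pi s).indicator (fun x => ENNReal.ofReal (gaussDensity n x)) x
      = ENNReal.ofReal ((Set.univ.pi s).indicator (gaussDensity n) x) := fun x => by
    by_cases hx : x ∈ Set.univ.pi s <;> simp [hx]
  simp only [this]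
  rw [← ofReal_integral_eq_lintegral_ofReal hint'
    (ae_of_all _ fun x => Set.indicator_nonneg (fun x _ => gaussDensity_nonneg x) x), hind,
    integral_fintype_prod_volume_eq_prod, ENNReal.ofReal_prod_of_nonneg]
  · refine Finset.prod_congr rfl fun i _ => ?_
    rw [gaussianReal_apply_eq_integral _ one_ne_zero, integral_indicator (hs i)]
  · exact fun i _ => integral_nonneg fun x =>
      Set.indicator_nonneg (fun x _ => gaussianPDFReal_nonneg _ _ _) x

theorem measurable_mulVec {n : ℕ} (M : Matrix (Fin n) (Fin n) ℝ) :
    Measurable fun x : Fin n → ℝ => M.mulVec x :=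
  (Matrix.mulVecLin M).continuous_of_finiteDimensional.measurable

/-- The density of the image of `gaussN n` under the invertible matrix `M`. -/
def mulVecDensity {n : ℕ} (M : Matrix (Fin n) (Fin n) ℝ) (x : Fin n → ℝ) : ℝ :=
  |M⁻¹.det| * Real.exp (1 / 2 * (‖WithLp.toLp 2 x‖ ^ 2 - ‖WithLp.toLp 2 (M⁻¹.mulVec x)‖ ^ 2))

theorem measurable_mulVecDensity {n : ℕ} (M : Matrix (Fin n) (Fin n) ℝ) :
    Measurable (mulVecDensity M) := by
  have h := measurable_mulVec M⁻¹
  unfold mulVecDensity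
  have h1 : Measurable fun x : Fin n → ℝ => ‖WithLp.toLp 2 x‖ ^ 2 :=
    ((PiLp.continuous_toLp 2 _).norm.pow 2).measurable
  exact ((((h1.sub (h1.comp h)).const_mul _).exp).const_mul _)

theorem gaussDensity_mul_mulVecDensity {n : ℕ} (M : Matrix (Fin n) (Fin n) ℝ) (x : Fin n → ℝ) :
    gaussDensity n x * mulVecDensity M x = |M⁻¹.det| * gaussDensity n (M⁻¹.mulVec x) := by
  have h : Real.exp (-(1 / 2 * ‖WithLp.toLp 2 x‖ ^ 2)) * Real.exp (1 / 2 *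
      (‖WithLp.toLp 2 x‖ ^ 2 - ‖WithLp.toLp 2 (M⁻¹.mulVec x)‖ ^ 2))
      = Real.exp (-(1 / 2 * ‖WithLp.toLp 2 (M⁻¹.mulVec x)‖ ^ 2)) := by
    rw [← Real.exp_add]
    ring_nf
  rw [gaussDensity_eq, gaussDensity_eq, mulVecDensity, ← h]
  ring

/-- Change of variables `y = Mx` in Lebesgue measure; the factor `exp(½‖y‖²)` in `mulVecDensity`
turns the resulting Lebesgue density into one relative to the Gaussian measure. -/
theorem map_mulVec_gaussN {n : ℕ} {M : Matrix (Fin n) (Fin n) ℝ} (hM : IsUnit M) :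
    (gaussN n).map (fun x => M.mulVec x)
      = (gaussN n).withDensity fun x => ENNReal.ofReal (mulVecDensity M x) := by
  have hdet : IsUnit M.det := (Matrix.isUnit_iff_isUnit_det M).1 hM
  have hgm : Measurable fun x => ENNReal.ofReal (gaussDensity n x) :=
    (measurable_gaussDensity n).ennreal_ofReal
  have hgM : Measurable fun x => ENNReal.ofReal (gaussDensity n (M⁻¹.mulVec x)) :=
    hgm.comp (measurable_mulVec M⁻¹)
  have hdm : Measurable fun x => ENNReal.ofReal (mulVecDensity M x) :=
    (measurable_mulVecDensity M).ennreal_ofReal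
  ext B hB
  rw [Measure.map_apply (measurable_mulVec M) hB, gaussN_eq_withDensity,
    withDensity_apply _ (measurable_mulVec M hB), withDensity_apply _ hB,
    setLIntegral_withDensity_eq_setLIntegral_mul _ hgm hdm hB]
  have hvol : (volume : Measure (Fin n → ℝ)).map (fun x => M.mulVec x)
      = ENNReal.ofReal |M⁻¹.det| • volume := by
    rw [Matrix.det_nonsing_inv, Ring.inverse_eq_inv']
    exact Real.map_matrix_volume_pi_eq_smul_volume_pi hdet.ne_zero
  calc ∫⁻ x in (fun x => M.mulVec x) ⁻¹' B, ENNReal.ofReal (gaussDensity n x)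
      = ∫⁻ x in (fun x => M.mulVec x) ⁻¹' B,
          ENNReal.ofReal (gaussDensity n (M⁻¹.mulVec (M.mulVec x))) := by
        simp only [Matrix.mulVec_mulVec, Matrix.nonsing_inv_mul M hdet, Matrix.one_mulVec]
    _ = ∫⁻ y in B, ENNReal.ofReal (gaussDensity n (M⁻¹.mulVec y))
          ∂(volume.map fun x => M.mulVec x) :=
        (setLIntegral_map hB hgM (measurable_mulVec M)).symm
    _ = ∫⁻ y in B, ENNReal.ofReal |M⁻¹.det| * ENNReal.ofReal (gaussDensity n (M⁻¹.mulVec y)) := by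
        rw [hvol, Measure.restrict_smul, lintegral_smul_measure, smul_eq_mul,
          lintegral_const_mul _ hgM]
    _ = _ := by
        refine lintegral_congr fun y => ?_
        rw [Pi.mul_apply, ← ENNReal.ofReal_mul (abs_nonneg _),
          ← ENNReal.ofReal_mul (gaussDensity_nonneg _), gaussDensity_mul_mulVecDensity]

theorem quasiMeasurePreserving_mulVec {n : ℕ} {M : Matrix (Fin n) (Fin n) ℝ} (hM : IsUnit M) :
    Measure.QuasiMeasurePreserving (fun x => M.mulVec x) (gaussN n) (gaussN n) :=
  ⟨measurable_mulVec M, by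
    rw [map_mulVec_gaussN hM]
    exact withDensity_absolutelyContinuous _ _⟩

/-! ### Uniform integrability -/

/-- De la Vallée-Poussin: a family on which a superlinear function has bounded integrals is
uniformly integrable. -/
theorem exists_setLIntegral_le_of_superlinearClass {ι : Type*} {X : ι → Type*}
    [∀ i, MeasurableSpace (X i)] {μ : ∀ i, Measure (X i)} {f : ∀ i, X i → ℝ}
    (h : (superlinearClass μ f).Nonempty) {ε : ℝ≥0∞} (hε : ε ≠ 0) :
    ∃ δ : ℝ≥0∞, δ ≠ 0 ∧ ∀ i (E : Set (X i)), MeasurableSet E → μ i E ≤ δ →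
      ∫⁻ x in E, ENNReal.ofReal (f i x) ∂(μ i) ≤ ε := by
  obtain ⟨G, hG0, -, -, hG, hsup⟩ := h
  set S := ⨆ i, ∫⁻ x, ENNReal.ofReal (G |f i x|) ∂(μ i) with hS
  obtain ⟨c, hc0, hc⟩ : ∃ c : ℝ, 0 < c ∧ ENNReal.ofReal c * S ≤ ε / 2 := by
    have hε2 : ε / 2 ≠ 0 := by simpa using hε
    obtain ⟨c, hc0, hc⟩ := ENNReal.exists_nnreal_pos_mul_lt hsup.ne hε2
    exact ⟨c, by exact_mod_cast hc0, by simpa using hc.le⟩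
  -- Superlinearity: above the level `T` the function is dominated by `c * G`, whose integral is at
  -- most `ε / 2`; below `T` it is bounded, and `δ` is chosen with `T * δ ≤ ε / 2`.
  obtain ⟨T, hT0, hT⟩ : ∃ T : ℝ, 0 < T ∧ ∀ t, T ≤ t → t ≤ c * G t := by
    obtain ⟨T, hT⟩ := eventually_atTop.1 (hG.eventually_ge_atTop c⁻¹)
    refine ⟨max T 1, by positivity, fun t ht => ?_⟩
    have ht0 : 0 < t := lt_of_lt_of_le (by positivity) ht
    have := hT t ((le_max_left _ _).trans ht)
    rw [le_div_iff₀ ht0, inv_mul_le_iff₀ hc0] at this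
    exact this
  refine ⟨ε / 2 / ENNReal.ofReal T, ?_, fun i E hE hμE => ?_⟩
  · simp [hε]
  have hpt : ∀ x, ENNReal.ofReal (f i x)
      ≤ ENNReal.ofReal T + ENNReal.ofReal c * ENNReal.ofReal (G |f i x|) := fun x => by
    rw [← ENNReal.ofReal_mul hc0.le]
    rcases le_total T |f i x| with h | h
    · exact (ENNReal.ofReal_le_ofReal ((le_abs_self _).trans (hT _ h))).trans le_add_self
    · exact (ENNReal.ofReal_le_ofReal ((le_abs_self _).trans h)).trans le_self_add
  calc ∫⁻ x in E, ENNReal.ofReal (f i x) ∂(μ i)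
      ≤ ∫⁻ x in E, (ENNReal.ofReal T + ENNReal.ofReal c * ENNReal.ofReal (G |f i x|)) ∂(μ i) :=
        lintegral_mono hpt
    _ = ENNReal.ofReal T * μ i E
          + ENNReal.ofReal c * ∫⁻ x in E, ENNReal.ofReal (G |f i x|) ∂(μ i) := by
        rw [lintegral_add_left measurable_const, setLIntegral_const,
          lintegral_const_mul' _ _ ENNReal.ofReal_ne_top]
    _ ≤ ε / 2 + ε / 2 := by
        gcongr
        · exact (mul_le_mul_right hμE _).trans ENNReal.mul_div_le
        · refine (mul_le_mul_right ?_ _).trans hc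
          exact (setLIntegral_le_lintegral _ _).trans
            (le_iSup (fun i => ∫⁻ x, ENNReal.ofReal (G |f i x|) ∂(μ i)) i)
    _ = ε := ENNReal.add_halves ε

/-! ### Nonsingularity of the infinite-dimensional transformation -/

/-- The first `m` rows vanish beyond a common column, so the series are finite sums that use only
the first `n` coordinates. -/
theorem exists_proj_infMatrixMap_eq {a : Matrix ℕ ℕ ℝ}
    (h_row : ∀ j : ℕ, ∃ K : ℕ, ∀ k, K ≤ k → a j k = 0) (m : ℕ) :
    ∃ N : ℕ, ∀ n, N ≤ n → ∀ hmn : m ≤ n,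
      proj m ∘ infMatrixMap a = projFin hmn ∘ truncMap a n ∘ proj n := by
  choose K hK using h_row
  refine ⟨(Finset.range m).sup K, fun n hn hmn => ?_⟩
  funext x i
  have hi : K i ≤ n := (Finset.le_sup (f := K) (Finset.mem_range.2 i.2)).trans hn
  simp only [Function.comp_apply, proj, infMatrixMap, projFin, truncMap, truncMatrix,
    Matrix.mulVec, dotProduct, Fin.val_castLE]
  rw [tsum_eq_sum (s := Finset.range n), Finset.sum_range]
  intro j hj
  rw [hK i j (hi.trans (by simpa using hj)), zero_mul]

theorem measurable_truncMap (a : Matrix ℕ ℕ ℝ) (n : ℕ) : Measurable (truncMap a n) :=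
  measurable_mulVec _

theorem measurable_infMatrixMap {a : Matrix ℕ ℕ ℝ}
    (h_row : ∀ j : ℕ, ∃ K : ℕ, ∀ k, K ≤ k → a j k = 0) : Measurable (infMatrixMap a) := by
  refine measurable_pi_lambda _ fun i => ?_
  obtain ⟨N, hN⟩ := exists_proj_infMatrixMap_eq h_row (i + 1)
  have h := hN (max N (i + 1)) (le_max_left _ _) (le_max_right _ _)
  have h' : Measurable (proj (i + 1) ∘ infMatrixMap a) := by
    rw [h]
    exact (measurable_projFin _).comp ((measurable_truncMap a _).comp (measurable_proj _))
  exact (measurable_pi_apply (⟨i, i.lt_succ_self⟩ : Fin (i + 1))).comp h'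

/-- An arbitrary finite measure is allowed because the density is needed for `μ + ν` as well as for
`μ`. -/
theorem measureDense_cylinders (ν : Measure (ℕ → ℝ)) [IsFiniteMeasure ν] :
    ν.MeasureDense cylinders :=
  Measure.MeasureDense.of_generateFrom_isSetAlgebra_finite ν isSetAlgebra_cylinders
    generateFrom_cylinders

/-- On the localizing set `proj k ⁻¹' σ`, the image measure is uniformly small on cylinder sets of
small Gaussian measure. -/
theorem exists_map_infMatrixMap_le {a : Matrix ℕ ℕ ℝ} (h_inv : ∀ n : ℕ+, IsUnit (truncMatrix a n))
    (h_row : ∀ j : ℕ, ∃ K : ℕ, ∀ k, K ≤ k → a j k = 0) {k : ℕ+} {σ : Set (Fin k → ℝ)}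
    (hσ : MeasurableSet σ)
    (h_class : (superlinearClass (ι := {n : ℕ+ // (k : ℕ) ≤ n}) (fun n => gaussN n)
      (fun n x => |((truncMatrix a n)⁻¹).det| * localizedDensity a n.2 σ x)).Nonempty)
    {ε : ℝ≥0∞} (hε : ε ≠ 0) :
    ∃ δ : ℝ≥0∞, δ ≠ 0 ∧ ∀ E ∈ cylinders, gaussInf E ≤ δ →
      gaussInf.map (infMatrixMap a) (E ∩ proj k ⁻¹' σ) ≤ ε := by
  obtain ⟨δ, hδ0, hδ⟩ := exists_setLIntegral_le_of_superlinearClass h_class hε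
  refine ⟨δ, hδ0, ?_⟩
  rintro _ ⟨m, τ, hτ, rfl⟩ hμ
  obtain ⟨N, hN⟩ := exists_proj_infMatrixMap_eq h_row (max k m : ℕ)
  -- This `n` depends on the cylinder set, but `δ` does not: uniform integrability holds over all `n
  -- ≥ k`. Taking `n ≥ max k m` lets `τ` and `σ` both be read off from the same `A_n`.
  let n : ℕ+ := ⟨max (max k m) N, lt_of_lt_of_le k.pos (by simp)⟩
  have hkmn : (max k m : ℕ) ≤ n := le_max_left _ _
  have hkn : (k : ℕ) ≤ n := (le_max_left _ _).trans hkmn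
  have hmn : (m : ℕ) ≤ n := (le_max_right _ _).trans hkmn
  have hA := hN n (le_max_right _ _) hkmn
  have hAm : proj m ∘ infMatrixMap a = projFin hmn ∘ truncMap a n ∘ proj n :=
    congrArg (fun g => projFin (le_max_right (k : ℕ) m) ∘ g) hA
  have hAk : proj k ∘ infMatrixMap a = projFin hkn ∘ truncMap a n ∘ proj n :=
    congrArg (fun g => projFin (le_max_left (k : ℕ) m) ∘ g) hA
  have hτ' : MeasurableSet (projFin hmn ⁻¹' τ) := measurable_projFin hmn hτ
  have hσ' : MeasurableSet (projFin hkn ⁻¹' σ) := measurable_projFin hkn hσ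
  have hset : infMatrixMap a ⁻¹' (proj m ⁻¹' τ ∩ proj k ⁻¹' σ)
      = proj n ⁻¹' (truncMap a n ⁻¹' (projFin hmn ⁻¹' τ ∩ projFin hkn ⁻¹' σ)) := by
    rw [Set.preimage_inter, ← Set.preimage_comp, ← Set.preimage_comp, hAm, hAk]
    rfl
  rw [Measure.map_apply (measurable_infMatrixMap h_row)
      ((measurable_proj m hτ).inter (measurable_proj k hσ)), hset,
    (measurePreserving_proj n).measure_preimage
      (measurable_truncMap a n (hτ'.inter hσ')).nullMeasurableSet,
    ← Measure.map_apply (measurable_truncMap a n) (hτ'.inter hσ')]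
  change (gaussN n).map (fun x => (truncMatrix a n).mulVec x) _ ≤ ε
  rw [map_mulVec_gaussN (h_inv n), withDensity_apply _ (hτ'.inter hσ'),
    Set.inter_comm, ← setLIntegral_indicator hσ']
  have hμ' : gaussN n (projFin hmn ⁻¹' τ) ≤ δ := by
    rw [← (measurePreserving_proj n).measure_preimage hτ'.nullMeasurableSet]
    exact hμ
  refine le_trans (le_of_eq ?_) (hδ ⟨n, hkn⟩ _ hτ' hμ')
  refine lintegral_congr fun x => ?_
  by_cases hx : x ∈ projFin hkn ⁻¹' σ
  · simp only [Set.indicator_of_mem hx, localizedDensity, mulVecDensity]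
  · simp only [Set.indicator_of_notMem hx, localizedDensity, mul_zero, ENNReal.ofReal_zero]

/-- The smallness estimate on cylinder sets passes to null sets by approximation; countably many
localizing sets then exhaust the space. -/
theorem quasiMeasurePreserving_infMatrixMap {a : Matrix ℕ ℕ ℝ}
    (h_inv : ∀ n : ℕ+, IsUnit (truncMatrix a n))
    (h_row : ∀ j : ℕ, ∃ K : ℕ, ∀ k, K ≤ k → a j k = 0) {σ : ∀ k : ℕ+, Set (Fin k → ℝ)}
    (h_meas : ∀ k, MeasurableSet (σ k)) (h_union : ⋃ k : ℕ+, proj k ⁻¹' σ k = Set.univ)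
    (h_class : ∀ k : ℕ+,
      (superlinearClass (ι := {n : ℕ+ // (k : ℕ) ≤ n}) (fun n => gaussN n)
        (fun n x => |((truncMatrix a n)⁻¹).det| * localizedDensity a n.2 (σ k) x)).Nonempty) :
    Measure.QuasiMeasurePreserving (infMatrixMap a) gaussInf gaussInf := by
  have hAm := measurable_infMatrixMap h_row
  have := Measure.isProbabilityMeasure_map (μ := gaussInf) hAm.aemeasurable
  refine ⟨hAm, Measure.AbsolutelyContinuous.mk fun s hs hs0 => ?_⟩
  set ν := gaussInf.map (infMatrixMap a) with hν
  have hs' : s = ⋃ k : ℕ+, s ∩ proj k ⁻¹' σ k := by rw [← Set.inter_iUnion, h_union, Set.inter_univ]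
  rw [hs', measure_iUnion_null_iff]
  intro k
  refine le_antisymm (ENNReal.le_of_forall_pos_le_add fun ε hε _ => ?_) zero_le
  have hε2 : (ε / 2 : ℝ≥0∞) ≠ 0 := by simpa using hε.ne'
  obtain ⟨δ, hδ0, hδ⟩ := exists_map_infMatrixMap_le h_inv h_row (h_meas k) (h_class k) hε2
  obtain ⟨η, hη0, hη⟩ : ∃ η : ℝ, 0 < η ∧ ENNReal.ofReal η < min δ (ε / 2) := by
    obtain ⟨η, h0, h1⟩ := ENNReal.lt_iff_exists_nnreal_btwn.1
      (lt_min (pos_iff_ne_zero.2 hδ0) (pos_iff_ne_zero.2 hε2))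
    exact ⟨η, by exact_mod_cast h0, by simpa using h1⟩
  -- Approximating in the sum of the measures makes `s ∆ E` small for both with one and the same
  -- `E`, before `ν ≪ μ` is known.
  obtain ⟨E, hE, hsE⟩ := (measureDense_cylinders (gaussInf + ν)).approx s hs
    (measure_ne_top _ _) η hη0
  rw [Measure.add_apply] at hsE
  have hEδ : gaussInf E ≤ δ := by
    calc gaussInf E ≤ gaussInf (s ∪ symmDiff s E) := measure_mono fun x hx => by
          by_cases hxs : x ∈ s
          · exact Or.inl hxs
          · exact Or.inr (Or.inr ⟨hx, hxs⟩)
      _ ≤ gaussInf s + gaussInf (symmDiff s E) := measure_union_le _ _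
      _ ≤ δ := by
          rw [hs0, zero_add]
          exact (le_self_add.trans hsE.le).trans (hη.le.trans (min_le_left _ _))
  calc ν (s ∩ proj k ⁻¹' σ k) ≤ ν (E ∩ proj k ⁻¹' σ k ∪ symmDiff s E) :=
        measure_mono fun x hx => by
          by_cases hxE : x ∈ E
          · exact Or.inl ⟨hxE, hx.2⟩
          · exact Or.inr (Or.inl ⟨hx.1, hxE⟩)
    _ ≤ ν (E ∩ proj k ⁻¹' σ k) + ν (symmDiff s E) := measure_union_le _ _
    _ ≤ ε / 2 + ε / 2 := add_le_add (hδ E hE hEδ)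
        ((le_add_self.trans hsE.le).trans (hη.le.trans (min_le_right _ _)))
    _ = 0 + ε := by rw [ENNReal.add_halves, zero_add]

/-! ### Graphs of composition operators -/

theorem mem_graph_domRestrict {R E F : Type*} [Ring R] [AddCommGroup E] [Module R E]
    [AddCommGroup F] [Module R F] {f : E →ₗ.[R] F} {S : Submodule R E} {x : E} {y : F} :
    (x, y) ∈ (f.domRestrict S).graph ↔ x ∈ S ∧ (x, y) ∈ f.graph := by
  constructor
  · intro h
    refine ⟨?_, LinearPMap.le_graph_of_le LinearPMap.domRestrict_le h⟩
    obtain ⟨z, hz, -⟩ := (LinearPMap.mem_graph_iff _).1 h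
    exact (show (z : E) = x from hz) ▸ z.2.1
  · rintro ⟨hx, h⟩
    obtain ⟨z, hz, hy⟩ := (LinearPMap.mem_graph_iff _).1 h
    have hz' : (z : E) = x := hz
    exact (LinearPMap.mem_graph_iff _).2 ⟨⟨x, hx, hz' ▸ z.2⟩, rfl,
      (LinearPMap.domRestrict_apply (x := ⟨x, hx, hz' ▸ z.2⟩) (y := z) hz'.symm).trans hy⟩

section CompositionOperators

variable {X : Type*} [MeasurableSpace X] {μ : Measure X} {A : X → X}

/-- The domain condition disappears: `g` lies in `L²`, so a.e. equality already forces `f ∘ A` into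
`L²`. -/
theorem mem_graph_compOp {hA : Measure.QuasiMeasurePreserving A μ μ} {f g : Lp ℂ 2 μ} :
    (f, g) ∈ (compOp hA).graph ↔ g =ᵐ[μ] f ∘ A := by
  constructor
  · intro h
    obtain ⟨z, hz, hg⟩ := (LinearPMap.mem_graph_iff _).1 h
    have hz' : (z : Lp ℂ 2 μ) = f := hz
    have hg' : MemLp.toLp ((z : Lp ℂ 2 μ) ∘ A) z.2 = g := hg
    rw [← hg', ← hz']
    exact MemLp.coeFn_toLp _
  · intro h
    have hf : MemLp (f ∘ A) 2 μ := (memLp_congr_ae h).1 (Lp.memLp g)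
    refine (LinearPMap.mem_graph_iff _).2 ⟨⟨f, hf⟩, rfl, ?_⟩
    change MemLp.toLp (f ∘ A) hf = g
    exact Lp.ext ((MemLp.coeFn_toLp _).trans h.symm)

/-- Convergence in `L²` gives a.e. convergence of a subsequence, and nonsingularity carries `f_n →
f` a.e. over to `f_n ∘ A → f ∘ A` a.e. -/
theorem isClosed_compOp (hA : Measure.QuasiMeasurePreserving A μ μ) : (compOp hA).IsClosed := by
  refine IsSeqClosed.isClosed fun u p hu hup => ?_
  obtain ⟨f, g⟩ := p
  obtain ⟨φ, hφ, hf⟩ := (tendstoInMeasure_of_tendsto_Lp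
    ((continuous_fst.tendsto _).comp hup)).exists_seq_tendsto_ae
  -- Extracted from the first subsequence, so that both components converge a.e. along it.
  obtain ⟨ψ, hψ, hg⟩ := (tendstoInMeasure_of_tendsto_Lp
    (((continuous_snd.tendsto _).comp hup).comp hφ.tendsto_atTop)).exists_seq_tendsto_ae
  refine mem_graph_compOp.2 ?_
  have hu' : ∀ᵐ x ∂μ, ∀ n, (u n).2 x = (u n).1 (A x) :=
    ae_all_iff.2 fun n => mem_graph_compOp.1 (hu n)
  filter_upwards [hA.ae hf, hg, hu'] with x h1 h2 h3
  refine tendsto_nhds_unique h2 ?_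
  simp only [Function.comp_apply, h3] at h1 ⊢
  exact h1.comp hψ.tendsto_atTop

theorem indicatorConstLp_mem_graph_compOp [IsFiniteMeasure μ]
    (hA : Measure.QuasiMeasurePreserving A μ μ) {s : Set X} (hs : MeasurableSet s) (c : ℂ) :
    (indicatorConstLp 2 hs (measure_ne_top μ s) c,
      indicatorConstLp 2 (hA.measurable hs) (measure_ne_top μ _) c) ∈ (compOp hA).graph :=
  mem_graph_compOp.2 (indicatorConstLp_coeFn.trans
    (hA.ae_eq_comp (indicatorConstLp_coeFn (hs := hs) (c := c))).symm)

/-- For a finite measure, indicators of measurable sets lie in the domain, and they span a dense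
subspace. -/
theorem dense_compOp_domain [IsFiniteMeasure μ] (hA : Measure.QuasiMeasurePreserving A μ μ) :
    Dense ((compOp hA).domain : Set (Lp ℂ 2 μ)) := by
  have : Fact ((2 : ℝ≥0∞) ≠ ∞) := ⟨by norm_num⟩
  refine fun f => ?_
  change f ∈ (compOp hA).domain.topologicalClosure
  refine Lp.induction (by norm_num) (fun f => f ∈ (compOp hA).domain.topologicalClosure)
    ?_ ?_ ?_ f
  · intro c s hs hμ
    rw [Lp.simpleFunc.coe_indicatorConst]
    exact Submodule.le_topologicalClosure _
      (LinearPMap.mem_domain_of_mem_graph (indicatorConstLp_mem_graph_compOp hA hs c))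
  · intro f g hf hg _ hf' hg'
    exact add_mem hf' hg'
  · exact (compOp hA).domain.isClosed_topologicalClosure

/-- The map `f ↦ f` from `L²(μ)` to `L²(ν)`, where `ν ≤ μ`. -/
def lpOfMeasureLE {ν : Measure X} (h : ν ≤ μ) : Lp ℂ 2 μ →L[ℂ] Lp ℂ 2 ν :=
  LinearMap.mkContinuous
    { toFun := fun f => ((Lp.memLp f).mono_measure h).toLp f
      map_add' := fun f g => by
        rw [← MemLp.toLp_add]
        exact MemLp.toLp_congr _ _ (ae_mono h (Lp.coeFn_add f g))
      map_smul' := fun c f => by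
        rw [RingHom.id_apply, ← MemLp.toLp_const_smul]
        exact MemLp.toLp_congr _ _ (ae_mono h (Lp.coeFn_smul c f)) } 1 fun f => by
    rw [one_mul, LinearMap.coe_mk, AddHom.coe_mk, Lp.norm_toLp, Lp.norm_def]
    exact ENNReal.toReal_mono (Lp.eLpNorm_ne_top f) (eLpNorm_mono_measure _ h)

theorem coeFn_lpOfMeasureLE {ν : Measure X} (h : ν ≤ μ) (f : Lp ℂ 2 μ) :
    lpOfMeasureLE h f =ᵐ[ν] f :=
  ((Lp.memLp f).mono_measure h).coeFn_toLp

theorem smul_indicatorConstLp_one {s : Set X} (hs : MeasurableSet s) (hμs : μ s ≠ ∞) (c : ℂ) :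
    c • indicatorConstLp 2 hs hμs (1 : ℂ) = indicatorConstLp 2 hs hμs c := by
  refine Lp.ext ?_
  filter_upwards [Lp.coeFn_smul c (indicatorConstLp 2 hs hμs (1 : ℂ)),
    indicatorConstLp_coeFn (p := 2) (hs := hs) (hμs := hμs) (c := (1 : ℂ)),
    indicatorConstLp_coeFn (p := 2) (hs := hs) (hμs := hμs) (c := c)] with x h1 h2 h3
  rw [h1, h3, Pi.smul_apply, h2]
  by_cases hx : x ∈ s <;> simp [hx]

/-- The graph norm of a composition operator is the norm of `L²(μ + μ ∘ A⁻¹)`; so a closed subspace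
that contains the graph over the indicators of a measure-dense family contains the whole graph. -/
theorem graph_compOp_le [IsFiniteMeasure μ] (hA : Measure.QuasiMeasurePreserving A μ μ)
    {𝒜 : Set (Set X)} (h𝒜 : (μ + μ.map A).MeasureDense 𝒜) {V : Submodule ℂ (Lp ℂ 2 μ × Lp ℂ 2 μ)}
    (hV : IsClosed (V : Set (Lp ℂ 2 μ × Lp ℂ 2 μ)))
    (hind : ∀ s (hs : s ∈ 𝒜), (indicatorConstLp 2 (h𝒜.measurable s hs) (measure_ne_top μ s) (1 : ℂ),
      indicatorConstLp 2 (hA.measurable (h𝒜.measurable s hs)) (measure_ne_top μ _) (1 : ℂ)) ∈ V) :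
    (compOp hA).graph ≤ V := by
  have : Fact ((2 : ℝ≥0∞) ≠ ∞) := ⟨by norm_num⟩
  have hmp : MeasurePreserving A μ (μ.map A) := ⟨hA.measurable, rfl⟩
  have h1 : μ ≤ μ + μ.map A := Measure.le_add_right le_rfl
  have h2 : μ.map A ≤ μ + μ.map A := Measure.le_add_left le_rfl
  -- `T` sends `f` to `(f, f ∘ A)`. It is continuous, so membership of `T f` in `V` need only be
  -- checked on a dense set.
  let T : Lp ℂ 2 (μ + μ.map A) →L[ℂ] Lp ℂ 2 μ × Lp ℂ 2 μ :=
    (lpOfMeasureLE h1).prod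
      ((Lp.compMeasurePreservingₗᵢ ℂ A hmp).toContinuousLinearMap.comp (lpOfMeasureLE h2))
  have hT : ∀ (f : Lp ℂ 2 (μ + μ.map A)) (g : X → ℂ) (F G : Lp ℂ 2 μ), f =ᵐ[μ + μ.map A] g →
      F =ᵐ[μ] g → G =ᵐ[μ] g ∘ A → T f = (F, G) := by
    intro f g F G hf hF hG
    refine Prod.ext (Lp.ext ?_) (Lp.ext ?_)
    · exact ((coeFn_lpOfMeasureLE h1 f).trans (ae_mono h1 hf)).trans hF.symm
    · refine (Lp.coeFn_compMeasurePreserving (lpOfMeasureLE h2 f) hmp).trans ?_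
      exact (hmp.quasiMeasurePreserving.ae_eq_comp
        ((coeFn_lpOfMeasureLE h2 f).trans (ae_mono h2 hf))).trans hG.symm
  have hTV : ∀ f, f ∈ V.comap (T : Lp ℂ 2 (μ + μ.map A) →ₗ[ℂ] Lp ℂ 2 μ × Lp ℂ 2 μ) := by
    have hcl : IsClosed {f | T f ∈ V} := hV.preimage T.continuous
    refine fun f => Lp.induction (by norm_num) (fun f => T f ∈ V) ?_ ?_ hcl f
    · intro c s hs hμ
      rw [Lp.simpleFunc.coe_indicatorConst]
      refine closure_minimal ?_ hcl
        (h𝒜.indicatorConstLp_subset_closure 2 c ⟨s, hs, hμ.ne, rfl⟩)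
      rintro _ ⟨t, ht, hμt, rfl⟩
      rw [Set.mem_ofPred_eq, hT _ (t.indicator fun _ => c) _ _ indicatorConstLp_coeFn
        (indicatorConstLp_coeFn (hs := h𝒜.measurable t ht) (hμs := measure_ne_top μ t))
        (indicatorConstLp_coeFn (hs := hA.measurable (h𝒜.measurable t ht))
          (hμs := measure_ne_top μ _))]
      have := V.smul_mem c (hind t ht)
      rwa [Prod.smul_mk, smul_indicatorConstLp_one, smul_indicatorConstLp_one] at this
    · intro f g hf hg _ hf' hg'
      rw [map_add]
      exact V.add_mem hf' hg'
  rintro ⟨F, G⟩ hFG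
  have hG := mem_graph_compOp.1 hFG
  have hFm : StronglyMeasurable F := Lp.stronglyMeasurable F
  -- Every graph element is in the range of `T`: `F ∘ A = G` in `L²(μ)` puts `F` in `L²(ν)`, hence
  -- in `L²(μ + ν)`.
  have hν : MemLp F 2 (μ.map A) :=
    (memLp_map_measure_iff hFm.aestronglyMeasurable hA.measurable.aemeasurable).2
      ((memLp_congr_ae hG).1 (Lp.memLp G))
  have hF : MemLp F 2 (μ + μ.map A) := by
    rw [memLp_two_iff_integrable_sq_norm hFm.aestronglyMeasurable]
    exact (Integrable.add_measure
      ((memLp_two_iff_integrable_sq_norm hFm.aestronglyMeasurable).1 (Lp.memLp F))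
      ((memLp_two_iff_integrable_sq_norm hFm.aestronglyMeasurable).1 hν))
  have := hTV (hF.toLp F)
  rw [Submodule.mem_comap] at this
  rw [← hT (hF.toLp F) F F G hF.coeFn_toLp (ae_eq_refl _) hG]
  exact this

end CompositionOperators

/-! ### Cylinder functions -/

/-- The indicator of a cylinder set, as an element of `L²`. -/
def cylinderIndicator {s : Set (ℕ → ℝ)} (hs : s ∈ cylinders) : Lp ℂ 2 gaussInf :=
  indicatorConstLp 2 ((measureDense_cylinders gaussInf).measurable s hs) (measure_ne_top _ s) (1 : ℂ)

theorem coeFn_cylinderIndicator {s : Set (ℕ → ℝ)} (hs : s ∈ cylinders) :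
    cylinderIndicator hs =ᵐ[gaussInf] s.indicator fun _ => 1 :=
  indicatorConstLp_coeFn

theorem inter_mem_cylinders {s t : Set (ℕ → ℝ)} (hs : s ∈ cylinders) (ht : t ∈ cylinders) :
    s ∩ t ∈ cylinders :=
  isSetAlgebra_cylinders.inter_mem hs ht

theorem projIsometry_indicatorConstLp {n : ℕ} {τ : Set (Fin n → ℝ)} (hτ : MeasurableSet τ) :
    projIsometry n (indicatorConstLp 2 hτ (measure_ne_top _ _) (1 : ℂ))
      = indicatorConstLp 2 (measurable_proj n hτ) (measure_ne_top _ _) (1 : ℂ) :=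
  Lp.indicatorConstLp_compMeasurePreserving hτ (measure_ne_top _ _) 1 (measurePreserving_proj n)

theorem projFinIsometry_indicatorConstLp {k l : ℕ} (h : k ≤ l) {τ : Set (Fin k → ℝ)}
    (hτ : MeasurableSet τ) :
    projFinIsometry h (indicatorConstLp 2 hτ (measure_ne_top _ _) (1 : ℂ))
      = indicatorConstLp 2 (measurable_projFin h hτ) (measure_ne_top _ _) (1 : ℂ) :=
  Lp.indicatorConstLp_compMeasurePreserving hτ (measure_ne_top _ _) 1 (measurePreserving_projFin h)

theorem cylinderIndicator_mem {s : Set (ℕ → ℝ)} (hs : s ∈ cylinders) :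
    cylinderIndicator hs ∈ cylinderSimple := by
  refine Submodule.subset_span ⟨⟨s, _, _, rfl⟩, ?_⟩
  obtain ⟨n, τ, hτ, rfl⟩ := hs
  exact ⟨n, _, projIsometry_indicatorConstLp hτ⟩

/-- The space `cylinderSimple` is spanned by the indicators of cylinder sets. -/
theorem cylinderSimple_le {V : Submodule ℂ (Lp ℂ 2 gaussInf)}
    (hV : ∀ s (hs : s ∈ cylinders), cylinderIndicator hs ∈ V) : cylinderSimple ≤ V := by
  refine Submodule.span_le.2 ?_
  rintro _ ⟨⟨s, hs, hμ, rfl⟩, n, g, hg⟩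
  have hg' : projIsometry n g = indicatorConstLp 2 hs hμ (1 : ℂ) := hg
  have hgm : Measurable g := (Lp.stronglyMeasurable g).measurable
  -- The set `s` itself need not be a cylinder set; it agrees up to a null set with the one where `g
  -- ∘ proj n = 1`.
  have hτ : proj n ⁻¹' (g ⁻¹' {1}) ∈ cylinders := ⟨n, _, hgm (measurableSet_singleton 1), rfl⟩
  suffices h : indicatorConstLp 2 hs hμ (1 : ℂ) = cylinderIndicator hτ from h ▸ hV _ hτ
  refine Lp.ext ?_
  have h1 : (projIsometry n g : (ℕ → ℝ) → ℂ) =ᵐ[gaussInf] g ∘ proj n :=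
    Lp.coeFn_compMeasurePreserving g (measurePreserving_proj n)
  rw [hg'] at h1
  filter_upwards [h1, indicatorConstLp_coeFn (p := 2) (hs := hs) (hμs := hμ) (c := (1 : ℂ)),
    coeFn_cylinderIndicator hτ] with x h1 h2 h3
  rw [h3, h2]
  rw [h2] at h1
  by_cases hx : x ∈ s
  · have : (1 : ℂ) = g (proj n x) := by simpa [hx] using h1
    simp [hx, ← this]
  · have : (0 : ℂ) = g (proj n x) := by simpa [hx] using h1
    simp [hx, ← this]

/-- The property is linear in `f`, so indicators of cylinder sets suffice, and cylinder sets are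
closed under intersection. -/
theorem exists_mem_cylinderSimple_indicator {t : Set (ℕ → ℝ)} (ht : t ∈ cylinders)
    {f : Lp ℂ 2 gaussInf} (hf : f ∈ cylinderSimple) :
    ∃ g ∈ cylinderSimple, g =ᵐ[gaussInf] t.indicator f := by
  let V : Submodule ℂ (Lp ℂ 2 gaussInf) :=
    { carrier := {f | ∃ g ∈ cylinderSimple, g =ᵐ[gaussInf] t.indicator f}
      zero_mem' := ⟨0, zero_mem _, by
        filter_upwards [Lp.coeFn_zero ℂ 2 gaussInf] with x hx
        by_cases hxt : x ∈ t
        · rw [Set.indicator_of_mem hxt]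
        · rw [Set.indicator_of_notMem hxt, hx, Pi.zero_apply]⟩
      add_mem' := by
        rintro f f' ⟨g, hg, hgf⟩ ⟨g', hg', hgf'⟩
        refine ⟨g + g', add_mem hg hg', ?_⟩
        filter_upwards [hgf, hgf', Lp.coeFn_add g g', Lp.coeFn_add f f'] with x h1 h2 h3 h4
        rw [h3, Pi.add_apply, h1, h2]
        by_cases hxt : x ∈ t
        · simp only [Set.indicator_of_mem hxt, h4, Pi.add_apply]
        · simp only [Set.indicator_of_notMem hxt, add_zero]
      smul_mem' := by
        rintro c f ⟨g, hg, hgf⟩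
        refine ⟨c • g, Submodule.smul_mem _ c hg, ?_⟩
        filter_upwards [hgf, Lp.coeFn_smul c g, Lp.coeFn_smul c f] with x h1 h2 h3
        by_cases hxt : x ∈ t <;> simp [hxt, h1, h2, h3] }
  refine cylinderSimple_le (V := V) (fun s hs => ?_) hf
  refine ⟨cylinderIndicator (inter_mem_cylinders ht hs), cylinderIndicator_mem _, ?_⟩
  filter_upwards [coeFn_cylinderIndicator (inter_mem_cylinders ht hs),
    coeFn_cylinderIndicator hs] with x h1 h2
  rw [h1, ← Set.indicator_indicator]
  by_cases hxt : x ∈ t <;> simp [hxt, h2]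

section Localized

variable {σ : ∀ k : ℕ+, Set (Fin k → ℝ)}

theorem preimage_proj_mem_cylinders (h_meas : ∀ k, MeasurableSet (σ k)) (k : ℕ+) :
    proj k ⁻¹' σ k ∈ cylinders :=
  ⟨k, σ k, h_meas k, rfl⟩

/-- `localizedCylinderSimple` as a linear subspace. -/
def localizedSubmodule (h_meas : ∀ k, MeasurableSet (σ k))
    (h_mono : Monotone fun k : ℕ+ => proj k ⁻¹' σ k) : Submodule ℂ (Lp ℂ 2 gaussInf) where
  carrier := localizedCylinderSimple σ
  zero_mem' := ⟨1, 0, zero_mem _, by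
    filter_upwards [Lp.coeFn_zero ℂ 2 gaussInf] with x hx
    by_cases hxt : x ∈ proj (1 : ℕ+) ⁻¹' σ 1
    · rw [Set.indicator_of_mem hxt]
    · rw [Set.indicator_of_notMem hxt, hx, Pi.zero_apply]⟩
  add_mem' := by
    rintro u v ⟨k, f, hf, hu⟩ ⟨l, g, hg, hv⟩
    -- Each summand is replaced by its own cutoff, which by monotonicity is unaffected by the larger
    -- cutoff at `max k l`.
    obtain ⟨f', hf', hff'⟩ :=
      exists_mem_cylinderSimple_indicator (preimage_proj_mem_cylinders h_meas k) hf
    obtain ⟨g', hg', hgg'⟩ :=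
      exists_mem_cylinderSimple_indicator (preimage_proj_mem_cylinders h_meas l) hg
    refine ⟨max k l, f' + g', add_mem hf' hg', ?_⟩
    have hk := h_mono (le_max_left k l)
    have hl := h_mono (le_max_right k l)
    filter_upwards [hu, hv, hff', hgg', Lp.coeFn_add u v, Lp.coeFn_add f' g']
      with x h1 h2 h3 h4 h5 h6
    have key : (u + v : Lp ℂ 2 gaussInf) x = (f' + g' : Lp ℂ 2 gaussInf) x := by
      rw [h5, h6, Pi.add_apply, Pi.add_apply, h1, h2, h3, h4]
    by_cases hx : x ∈ proj (max k l : ℕ+) ⁻¹' σ (max k l)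
    · rw [Set.indicator_of_mem hx, key]
    · rw [Set.indicator_of_notMem hx, h5, Pi.add_apply, h1, h2,
        Set.indicator_of_notMem fun h => hx (hk h), Set.indicator_of_notMem fun h => hx (hl h),
        add_zero]
  smul_mem' := by
    rintro c u ⟨k, f, hf, hu⟩
    refine ⟨k, c • f, Submodule.smul_mem _ c hf, ?_⟩
    filter_upwards [hu, Lp.coeFn_smul c u, Lp.coeFn_smul c f] with x h1 h2 h3
    by_cases hxt : x ∈ proj k ⁻¹' σ k <;> simp [hxt, h1, h2, h3]

theorem localizedSubmodule_le (h_meas : ∀ k, MeasurableSet (σ k))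
    (h_mono : Monotone fun k : ℕ+ => proj k ⁻¹' σ k) :
    localizedSubmodule h_meas h_mono ≤ cylinderSimple := by
  rintro u ⟨k, f, hf, hu⟩
  obtain ⟨g, hg, hgf⟩ :=
    exists_mem_cylinderSimple_indicator (preimage_proj_mem_cylinders h_meas k) hf
  rwa [Lp.ext (hu.trans hgf.symm)]

theorem cylinderIndicator_inter_mem_localizedSubmodule (h_meas : ∀ k, MeasurableSet (σ k))
    (h_mono : Monotone fun k : ℕ+ => proj k ⁻¹' σ k) {s : Set (ℕ → ℝ)} (hs : s ∈ cylinders)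
    (k : ℕ+) :
    cylinderIndicator (inter_mem_cylinders hs (preimage_proj_mem_cylinders h_meas k))
      ∈ localizedSubmodule h_meas h_mono := by
  refine ⟨k, cylinderIndicator hs, cylinderIndicator_mem hs, ?_⟩
  filter_upwards [coeFn_cylinderIndicator hs, coeFn_cylinderIndicator
    (inter_mem_cylinders hs (preimage_proj_mem_cylinders h_meas k))] with x h1 h2
  rw [h2, Set.inter_comm, ← Set.indicator_indicator]
  by_cases hx : x ∈ proj k ⁻¹' σ k <;> simp [hx, h1]

end Localized

/-! ### The limit operator on cylinder functions -/

/-- On `cylinderSimple` the limit of the operators `C_{Aₙ}` exists and equals `C_A`. -/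
theorem cylinderSimple_le_map_fst {a : Matrix ℕ ℕ ℝ}
    (h_row : ∀ j : ℕ, ∃ K : ℕ, ∀ k, K ≤ k → a j k = 0)
    (hAn : ∀ n : ℕ+, Measure.QuasiMeasurePreserving (truncMap a n) (gaussN n) (gaussN n))
    (hA : Measure.QuasiMeasurePreserving (infMatrixMap a) gaussInf gaussInf) :
    cylinderSimple ≤ ((limGraph gaussInductiveLimit fun n => compOp (hAn n)) ⊓
      (compOp hA).graph).map (LinearMap.fst ℂ _ _) := by
  -- The target is the projection of an intersection of two graphs, hence a subspace, so generators
  -- suffice.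
  refine cylinderSimple_le fun s hs => ?_
  refine ⟨_, ⟨?_, indicatorConstLp_mem_graph_compOp hA
    ((measureDense_cylinders gaussInf).measurable s hs) 1⟩, rfl⟩
  obtain ⟨k, τ, hτ, rfl⟩ := hs
  obtain ⟨N, hN⟩ := exists_proj_infMatrixMap_eq h_row k
  let τ' (m : ℕ+) : Set (Fin m → ℝ) := if h : (k : ℕ) ≤ m then projFin h ⁻¹' τ else ∅
  have hτ' : ∀ m, MeasurableSet (τ' m) := fun m => by
    by_cases h : (k : ℕ) ≤ m
    · simp only [τ', dif_pos h]
      exact measurable_projFin h hτ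
    · simp only [τ', dif_neg h, MeasurableSet.empty]
  have hτ'_eq : ∀ {m : ℕ+} (h : (k : ℕ) ≤ m), τ' m = projFin h ⁻¹' τ := fun h => dif_pos h
  refine ⟨k, indicatorConstLp 2 hτ (measure_ne_top _ _) 1,
    (projIsometry_indicatorConstLp hτ).symm,
    fun m => indicatorConstLp 2 ((hAn m).measurable (hτ' m)) (measure_ne_top _ _) 1,
    ⟨k, le_rfl, fun m _ hkm => ?_⟩, ?_⟩
  · have hkm' : (k : ℕ) ≤ m := (PNat.coe_le_coe k m).2 hkm
    convert indicatorConstLp_mem_graph_compOp (hAn m) (hτ' m) 1 using 2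
    refine (projFinIsometry_indicatorConstLp hkm' hτ).trans ?_
    congr 1
    exact (hτ'_eq hkm').symm
  · refine tendsto_const_nhds.congr' ?_
    -- From here on the sequence is constant. The bound is `N + 1` because `N` may be zero and the
    -- index is positive.
    filter_upwards [eventually_ge_atTop (max k ⟨N + 1, N.succ_pos⟩)] with m hm
    have hkm : (k : ℕ) ≤ m := (PNat.coe_le_coe k m).2 ((le_max_left _ _).trans hm)
    have hNm : N + 1 ≤ (m : ℕ) :=
      (PNat.coe_le_coe ⟨N + 1, N.succ_pos⟩ m).2 ((le_max_right _ _).trans hm)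
    refine Eq.trans ?_ (projIsometry_indicatorConstLp ((hAn m).measurable (hτ' m))).symm
    congr 1
    rw [hτ'_eq hkm, ← Set.preimage_comp, hN m (by omega) hkm]
    rfl

/-- Both operators are single-valued and share a value at every vector of `cylinderSimple`, so their
graphs over `D` coincide. -/
theorem mem_graph_domRestrict_limOp_iff {a : Matrix ℕ ℕ ℝ}
    (h_row : ∀ j : ℕ, ∃ K : ℕ, ∀ k, K ≤ k → a j k = 0)
    (hAn : ∀ n : ℕ+, Measure.QuasiMeasurePreserving (truncMap a n) (gaussN n) (gaussN n))
    (hA : Measure.QuasiMeasurePreserving (infMatrixMap a) gaussInf gaussInf)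
    {D : Submodule ℂ (Lp ℂ 2 gaussInf)} (hD : D ≤ cylinderSimple) {f g : Lp ℂ 2 gaussInf} :
    (f, g) ∈ ((limOp gaussInductiveLimit fun n => compOp (hAn n)).domRestrict D).graph ↔
      f ∈ D ∧ (f, g) ∈ (compOp hA).graph := by
  rw [mem_graph_domRestrict, and_congr_right_iff]
  intro hf
  obtain ⟨⟨f', g'⟩, ⟨hlim, hcomp⟩, rfl⟩ := cylinderSimple_le_map_fst h_row hAn hA (hD hf)
  rw [← limOp_graph] at hlim
  constructor <;> intro h
  · rwa [← LinearPMap.mem_graph_snd_inj _ hlim h rfl]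
  · rwa [← LinearPMap.mem_graph_snd_inj _ hcomp h rfl]

/-- One inclusion is closedness of `C_A`; the other is `graph_compOp_le` applied to the closure,
which contains the graph over every cylinder indicator as a limit of localized ones. -/
theorem topologicalClosure_graph_domRestrict_limOp {a : Matrix ℕ ℕ ℝ}
    (h_row : ∀ j : ℕ, ∃ K : ℕ, ∀ k, K ≤ k → a j k = 0) {σ : ∀ k : ℕ+, Set (Fin k → ℝ)}
    (h_meas : ∀ k, MeasurableSet (σ k)) (h_mono : Monotone fun k : ℕ+ => proj k ⁻¹' σ k)
    (h_union : ⋃ k : ℕ+, proj k ⁻¹' σ k = Set.univ)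
    (hAn : ∀ n : ℕ+, Measure.QuasiMeasurePreserving (truncMap a n) (gaussN n) (gaussN n))
    (hA : Measure.QuasiMeasurePreserving (infMatrixMap a) gaussInf gaussInf) :
    ((limOp gaussInductiveLimit fun n => compOp (hAn n)).domRestrict
      (localizedSubmodule h_meas h_mono)).graph.topologicalClosure = (compOp hA).graph := by
  have hmem := @mem_graph_domRestrict_limOp_iff a h_row hAn hA _
    (localizedSubmodule_le h_meas h_mono)
  refine le_antisymm ?_ ?_
  · refine Submodule.topologicalClosure_minimal _ ?_ (isClosed_compOp hA)
    rintro ⟨f, g⟩ h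
    exact (hmem.1 h).2
  have := Measure.isProbabilityMeasure_map (μ := gaussInf) hA.measurable.aemeasurable
  refine graph_compOp_le hA (measureDense_cylinders _) (Submodule.isClosed_topologicalClosure _)
    fun s hs => ?_
  have hcyl := preimage_proj_mem_cylinders h_meas
  have hsm : MeasurableSet s := (measureDense_cylinders gaussInf).measurable s hs
  have hkm : ∀ k : ℕ+, MeasurableSet (s ∩ proj k ⁻¹' σ k) :=
    fun k => hsm.inter (measurable_proj k (h_meas k))
  -- Needed for `μ` and for the image measure, to control the two components of the graph; the
  -- symmetric differences decrease to the empty set.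
  have hlim : ∀ (ν : Measure (ℕ → ℝ)) [IsFiniteMeasure ν],
      Tendsto (fun k : ℕ+ => ν (symmDiff (s ∩ proj k ⁻¹' σ k) s)) atTop (𝓝 0) := by
    intro ν _
    have hs0 : ⋂ k : ℕ+, symmDiff (s ∩ proj k ⁻¹' σ k) s = ∅ := by
      refine Set.eq_empty_of_forall_notMem fun x hx => ?_
      obtain ⟨k, hk⟩ := Set.mem_iUnion.1 (h_union ▸ Set.mem_univ x)
      rcases Set.mem_iInter.1 hx k with h | h
      · exact h.2 h.1.1
      · exact h.2 ⟨h.1, hk⟩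
    rw [← measure_empty (μ := ν), ← hs0]
    refine tendsto_measure_iInter_atTop (fun k => ((hkm k).symmDiff hsm).nullMeasurableSet) ?_
      ⟨1, measure_ne_top _ _⟩
    rintro k l hkl x (h | h)
    · exact absurd h.1.1 h.2
    · exact Or.inr ⟨h.1, fun h' => h.2 ⟨h.1, h_mono hkl h'.2⟩⟩
  refine mem_closure_of_tendsto (b := atTop) (f := fun k : ℕ+ =>
    (indicatorConstLp 2 (hkm k) (measure_ne_top gaussInf _) (1 : ℂ),
      indicatorConstLp 2 (hA.measurable (hkm k)) (measure_ne_top gaussInf _) (1 : ℂ)))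
    (Tendsto.prodMk_nhds ?_ ?_) (Eventually.of_forall fun k => ?_)
  · exact tendsto_indicatorConstLp_set (by norm_num) (hlim gaussInf)
  · refine tendsto_indicatorConstLp_set (by norm_num) ?_
    refine (hlim (gaussInf.map (infMatrixMap a))).congr fun k => ?_
    rw [Measure.map_apply hA.measurable ((hkm k).symmDiff hsm)]
    rfl
  · exact hmem.2 ⟨cylinderIndicator_inter_mem_localizedSubmodule h_meas h_mono hs k,
      indicatorConstLp_mem_graph_compOp hA (hkm k) 1⟩

end GaussComp

end

/-! ### The composition operator as the closure of the limit operator -/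

theorem corollary5p1 (a : Matrix ℕ ℕ ℝ)
    (h_inv : ∀ n : ℕ+, IsUnit (truncMatrix a n))
    (h_row : ∀ j : ℕ, ∃ K : ℕ, ∀ k, K ≤ k → a j k = 0)
    (σ : ∀ k : ℕ+, Set (Fin k → ℝ))
    (h_meas : ∀ k, MeasurableSet (σ k))
    (h_mono : Monotone fun k : ℕ+ => proj k ⁻¹' σ k)
    (h_union : ⋃ k : ℕ+, proj k ⁻¹' σ k = Set.univ)
    (h_int : ∀ (k n : ℕ+) (hkn : (k : ℕ) ≤ n),
      Integrable (localizedDensity a hkn (σ k)) (gaussN n))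
    (h_class : ∀ k : ℕ+,
      (superlinearClass (ι := {n : ℕ+ // (k : ℕ) ≤ n}) (fun n => gaussN n)
        (fun n x => |((truncMatrix a n)⁻¹).det| * localizedDensity a n.2 (σ k) x)).Nonempty) :
    ∃ (hAn : ∀ n : ℕ+, Measure.QuasiMeasurePreserving (truncMap a n) (gaussN n) (gaussN n))
      (hA : Measure.QuasiMeasurePreserving (infMatrixMap a) gaussInf gaussInf)
      (D : Submodule ℂ (Lp ℂ 2 gaussInf)),
      Dense ((compOp hA).domain : Set (Lp ℂ 2 gaussInf)) ∧
      (D : Set (Lp ℂ 2 gaussInf)) = localizedCylinderSimple σ ∧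
      D ≤ (limOp gaussInductiveLimit fun n => compOp (hAn n)).domain ∧
      ((limOp gaussInductiveLimit fun n => compOp (hAn n)).domRestrict D).IsClosable ∧
      compOp hA = ((limOp gaussInductiveLimit fun n => compOp (hAn n)).domRestrict D).closure := by
  have hAn : ∀ n : ℕ+, Measure.QuasiMeasurePreserving (truncMap a n) (gaussN n) (gaussN n) :=
    fun n => quasiMeasurePreserving_mulVec (h_inv n)
  have hA := quasiMeasurePreserving_infMatrixMap h_inv h_row h_meas h_union h_class
  have hgraph := topologicalClosure_graph_domRestrict_limOp h_row h_meas h_mono h_union hAn hA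
  -- Closable because the closure of the graph is again the graph of an operator, namely `C_A`.
  have hclos : ((limOp gaussInductiveLimit fun n => compOp (hAn n)).domRestrict
      (localizedSubmodule h_meas h_mono)).IsClosable := ⟨compOp hA, hgraph⟩
  refine ⟨hAn, hA, localizedSubmodule h_meas h_mono, dense_compOp_domain hA, rfl, fun f hf => ?_,
    hclos, LinearPMap.eq_of_eq_graph ?_⟩
  · obtain ⟨⟨f', g⟩, ⟨hlim, -⟩, rfl⟩ :=
      cylinderSimple_le_map_fst h_row hAn hA (localizedSubmodule_le h_meas h_mono hf)
    rw [SetLike.mem_coe, ← limOp_graph] at hlim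
    exact LinearPMap.mem_domain_of_mem_graph hlim
  · rw [← hclos.graph_closure_eq_closure_graph, hgraph]
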